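/- An \emph{$\omega$-Stone space} is a totally disconnected, locally compact Hausdorff space that is second countable (equivalently, the Stone space of a countable Boolean ring). For a topological space $W$ let $W^{(0)}=W$, let $W^{(\xi+1)}$ be the set of limit points of $W^{(\xi)}$, and let $W^{(\eta)}=\bigcap_{\xi<\eta}W^{(\xi)}$ for limit ordinals $\eta$; put $W^{[\xi]}=W^{(\xi)}\setminus W^{(\xi+1)}$. For an $\omega$-Stone space $W$ define \[ \begin{aligned} \nu(W)&=\min\{\xi: W^{(\xi)}=W^{(\xi+1)}\}, & K(W)&=W^{(\nu(W))},\\ \lambda(W)&=\min\{\xi: W^{(\xi)}\setminus K(W)\text{ is closed}\}, & \rho(W)&=\min\{\xi:\overline{W^{[\xi]}}\text{ is compact}\}, \end{aligned} \] let $n(W)=|W^{(\mu)}\setminus K(W)|$ if $\nu(W)=\mu+1$ and this set is finite, and $n(W)=-\infty$ otherwise. Let $r_W\colon K(W)\to\omega_1$ be the rank function $r_W(x)=\min\{\xi\in\omega_1: x\notin\overline{W^{(\xi)}\setminus K(W)}\}$, let $K_\xi(W)=\{x\in K(W): r_W(x)>\xi\}$, and let $\rho_U(W)=\min\{\xi: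 K_\xi(W)\text{ is compact}\}$. The space $W$ is \emph{scattered} if $K(W)=\emptyset$, \emph{uniform} if $\nu(W)=\lambda(W)$, and \emph{strongly uniform} if it is uniform and $\rho_U(W)=\rho(W)$. \textbf{Theorem.} Every $\omega$-Stone space $W$ is a disjoint union $W=X\sqcup Y$ of two clopen subsets $X,Y$ such that: \begin{enumerate} \item either $X=\emptyset$, or $X$ is strongly uniform with $\lambda(X)=\lambda(W)$, $K(X)=K(W)$ and $r_X=r_W$; \item if $\rho(W)=\rho_U(W)$ and $\nu(W)=\lambda(W)$, then $Y=\emptyset$; otherwise $Y$ is scattered and \begin{itemize} \item[(i)] $n(Y)=n(W)$; \item[(ii)] $\rho(Y)=\rho(W)$ if $\rho_U(W)\neq\rho(W)$, and $\rho(Y)=0$ if $\rho_U(W)=\rho(W)$; \item[(iii)] $\nu(Y)=\nu(W)$ if $\lambda(W)\neq\nu(W)$, and $\nu(Y)=\rho(W)$ if $\lambda(W)=\nu(W)$. \end{itemize} \end{enumerate} -/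

import Mathlib

open Set Topology

universe u

noncomputable section

namespace OmegaStone

variable (W : Type u) [TopologicalSpace W]

/-- The term `W^(ξ)` of the Cantor-Bendixson sequence of a topological space `W`:
`W^(0) = W`, `W^(ξ+1)` is the set of limit points of `W^(ξ)`, and `W^(η)` is the
intersection of the earlier terms at a limit ordinal `η` (see the three lemmas below). -/
def cb (ξ : Ordinal.{u}) : Set W := CantorBendixson.iteratedDerivedSet (univ : Set W) ξ

theorem cb_zero : cb W 0 = univ := CantorBendixson.iteratedDerivedSet_zero

theorem cb_add_one (ξ : Ordinal.{u}) : cb W (ξ + 1) = derivedSet (cb W ξ) := by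
  have h : cb W (ξ + 1) = relDerivedSet (cb W ξ) := CantorBendixson.iteratedDerivedSet_succ
  rw [h, IsClosed.relDerivedSet_eq]
  exact CantorBendixson.isClosed_iteratedDerivedSet isClosed_univ ξ

theorem cb_limit {η : Ordinal.{u}} (hη : Order.IsSuccLimit η) :
    cb W η = ⋂ ξ : Iio η, cb W ξ :=
  CantorBendixson.iteratedDerivedSet_limit hη

/-- The layer `W^[ξ] = W^(ξ) - W^(ξ+1)`. -/
def layer (ξ : Ordinal.{u}) : Set W := cb W ξ \ cb W (ξ + 1)

/-- `ν(W) = min {ξ | W^(ξ) = W^(ξ+1)}`. -/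
def nu : Ordinal.{u} := sInf {ξ | cb W ξ = cb W (ξ + 1)}

/-- The minimum in the definition of `ν(W)` is attained. -/
theorem cb_nu : cb W (nu W) = cb W (nu W + 1) := by
  have h : {ξ : Ordinal.{u} | cb W ξ = cb W (ξ + 1)}.Nonempty := by
    obtain ⟨a, ha⟩ := CantorBendixson.iteratedDerivedSet_mem_fixedPoints (univ : Set W)
    refine ⟨a, ?_⟩
    have h1 : cb W (a + 1) = relDerivedSet (cb W a) := CantorBendixson.iteratedDerivedSet_succ
    exact (h1.trans ha).symm
  exact csInf_mem h

/-- The perfect kernel `K(W) = W^(ν(W))`. -/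
def kernel : Set W := cb W (nu W)

/-- `λ(W) = min {ξ | W^(ξ) - K(W) is closed}`. -/
def lam : Ordinal.{u} := sInf {ξ | IsClosed (cb W ξ \ kernel W)}

open Classical in
/-- `n(W) = |W^(μ) - K(W)|` if `ν(W) = μ + 1` and this set is finite, and `-∞` (that is, `⊥`)
otherwise. -/
def num : WithBot ℕ :=
  if h : ∃ μ, nu W = μ + 1 ∧ (cb W μ \ kernel W).Finite then
    ((cb W h.choose \ kernel W).ncard : WithBot ℕ)
  else ⊥

theorem num_eq {μ : Ordinal.{u}} (h : nu W = μ + 1) (hf : (cb W μ \ kernel W).Finite) :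
    num W = ((cb W μ \ kernel W).ncard : WithBot ℕ) := by
  have hex : ∃ μ, nu W = μ + 1 ∧ (cb W μ \ kernel W).Finite := ⟨μ, h, hf⟩
  have e : hex.choose = μ := by
    have := hex.choose_spec.1.symm.trans h
    exact Order.succ_injective (by simpa using this)
  rw [num, dif_pos hex, e]

/-- The rank function `r_W : K(W) → ω₁`,
`r_W(x) = min {ξ ∈ ω₁ | x ∉ closure (W^(ξ) - K(W))}`. -/
def rank (x : kernel W) : Ordinal.{u} :=
  sInf {ξ | ξ < Ordinal.omega 1 ∧ (x : W) ∉ closure (cb W ξ \ kernel W)}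

/-- `K_ξ(W) = {w ∈ K(W) | r_W(w) > ξ}`. -/
def kernelAbove (ξ : Ordinal.{u}) : Set W := {w | ∃ h : w ∈ kernel W, ξ < rank W ⟨w, h⟩}

/-- The compact rank `ρ(W) = min {ξ | the closure of W^[ξ] is compact}`. -/
def rho : Ordinal.{u} := sInf {ξ | IsCompact (closure (layer W ξ))}

/-- The uniform compact rank `ρ_U(W) = min {ξ | K_ξ(W) is compact}`. -/
def rhoU : Ordinal.{u} := sInf {ξ | IsCompact (kernelAbove W ξ)}

/-- `W` is scattered if its perfect kernel is empty. -/
def Scattered : Prop := kernel W = ∅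

/-- `W` is uniform if `ν(W) = λ(W)`. -/
def Uniform : Prop := nu W = lam W

/-- `W` is strongly uniform if it is uniform and `ρ_U(W) = ρ(W)`. -/
def StronglyUniform : Prop := Uniform W ∧ rhoU W = rho W

/-- An `ω`-Stone space: a totally disconnected locally compact Hausdorff space that is second
countable. These are the Stone spaces of the countable Boolean rings. -/
class OmegaStoneSpace : Prop extends T2Space W, LocallyCompactSpace W,
  TotallyDisconnectedSpace W, SecondCountableTopology W

end OmegaStone

end

namespace OmegaStone

/-! ### Cantor-Bendixson sequence, ranks and compactness thresholds -/

section CantorBendixson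

variable {W : Type u} [TopologicalSpace W]

/-! Write D_ξ = W^(ξ) \ K(W), a decreasing family. Every invariant can be read off it: λ, ρ and ν
are the first stages at which D_ξ is closed, has compact closure (`closure_layer`), or is empty, and
K_ξ = K ∩ closure D_ξ (`kernelAbove_eq`).

Choose a compact clopen C ⊇ K_{ρ_U}. Then D_{ρ_U} \ C is closed (`isClosed_cb_diff_kernel_diff`), as
is D_λ, so a clopen Y disjoint from K contains both (`exists_isClopen_separating`). Put X = Yᶜ.
Since K ⊆ X, the ranks, λ and ρ_U do not change; D_λ misses X, so ν(X) = λ(X); and X ∩ D_{ρ_U} ⊆ C,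
so ρ(X) = ρ_U(X). When λ < ν, Y carries the top stages and so has the ν and n of W; when ρ_U < ρ it
carries D_{ρ_U} outside a compact set and so has the ρ of W.

The degenerate cases adjust Y. If ρ_U = ρ and λ < ν, then D_λ is compact and Y can be compact. If
ρ_U < ρ and λ = ν, then D_λ is empty; C is enlarged to contain closure D_ρ and Y avoids C, which
forces ν(Y) = ρ(W). -/

theorem isClosed_cb (ξ : Ordinal.{u}) : IsClosed (cb W ξ) :=
  CantorBendixson.isClosed_iteratedDerivedSet isClosed_univ ξ

theorem cb_antitone : Antitone (cb W) := CantorBendixson.iteratedDerivedSet_antitone _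

theorem kernel_subset_cb (ξ : Ordinal.{u}) : kernel W ⊆ cb W ξ := by
  have h : ∀ η, cb W (nu W) ⊆ cb W η := by
    intro η
    induction η using Ordinal.limitRecOn with
    | zero => simp [cb_zero]
    | add_one a ha =>
      rw [cb_nu W, cb_add_one, cb_add_one]
      exact derivedSet_mono _ _ ha
    | limit a ha ih =>
      rw [cb_limit W ha]
      exact subset_iInter fun i => ih i i.2
  exact h ξ

theorem kernel_eq_cb {ξ : Ordinal.{u}} (h : nu W ≤ ξ) : kernel W = cb W ξ :=
  (kernel_subset_cb ξ).antisymm (cb_antitone h)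

theorem isClosed_kernel : IsClosed (kernel W) := isClosed_cb _

theorem nu_le_of_cb_eq_kernel {ξ : Ordinal.{u}} (h : cb W ξ = kernel W) : nu W ≤ ξ :=
  csInf_le' <| (h.subset.trans (kernel_subset_cb _)).antisymm
    (cb_antitone (Order.le_succ ξ))

theorem nu_le_iff {ξ : Ordinal.{u}} : nu W ≤ ξ ↔ cb W ξ \ kernel W = ∅ :=
  ⟨fun h => by rw [kernel_eq_cb h, sdiff_self], fun h => nu_le_of_cb_eq_kernel <|
    (sdiff_eq_empty.1 h).antisymm (kernel_subset_cb ξ)⟩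

theorem isClosed_cb_diff_kernel_iff {ξ : Ordinal.{u}} :
    IsClosed (cb W ξ \ kernel W) ↔ lam W ≤ ξ := by
  refine ⟨fun h => csInf_le' h, fun h => ?_⟩
  have hl : IsClosed (cb W (lam W) \ kernel W) :=
    csInf_mem (s := {ξ | IsClosed (cb W ξ \ kernel W)}) ⟨nu W, by simp [kernel]⟩
  have : cb W ξ \ kernel W = cb W ξ ∩ (cb W (lam W) \ kernel W) := by
    ext x
    have := @cb_antitone W _ _ _ h x
    simp only [mem_sdiff, mem_inter_iff]
    tauto
  rw [this]
  exact (isClosed_cb _).inter hl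

theorem lam_le_nu : lam W ≤ nu W :=
  isClosed_cb_diff_kernel_iff.1 (by simp [kernel])

theorem cb_diff_kernel_antitone : Antitone fun ξ => cb W ξ \ kernel W :=
  fun _ _ h => sdiff_subset_sdiff_left (cb_antitone h)

/-- On an open set, the Cantor-Bendixson sequence is constant from the first stage at which it
stabilizes there. -/
theorem inter_cb_subset_kernel {U : Set W} (hU : IsOpen U) {ξ : Ordinal.{u}}
    (h : U ∩ cb W ξ ⊆ cb W (ξ + 1)) : U ∩ cb W ξ ⊆ kernel W := by
  suffices ∀ η, U ∩ cb W ξ ⊆ cb W η from this _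
  intro η
  induction η using Ordinal.limitRecOn with
  | zero => simp [cb_zero]
  | add_one a ha =>
    intro x hx
    have h1 : AccPt x (Filter.principal (cb W ξ)) := by
      have := h hx
      rwa [cb_add_one] at this
    rw [cb_add_one, mem_derivedSet]
    exact (h1.nhds_inter (hU.mem_nhds hx.1)).mono (Filter.principal_mono.2 ha)
  | limit a ha ih =>
    rw [cb_limit W ha]
    exact subset_iInter fun i => ih i i.2

/-- On the open complement of the closure of the layer, the sequence is already stable at stage ξ,
so only kernel points of W^(ξ) remain there. -/
theorem closure_layer (ξ : Ordinal.{u}) :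
    closure (layer W ξ) = closure (cb W ξ \ kernel W) := by
  refine (closure_mono <| sdiff_subset_sdiff_right <| kernel_subset_cb _).antisymm ?_
  refine closure_minimal (fun x hx => ?_) isClosed_closure
  by_contra hc
  refine hx.2 (inter_cb_subset_kernel (U := (closure (layer W ξ))ᶜ)
    isClosed_closure.isOpen_compl ?_ ⟨hc, hx.1⟩)
  intro y hy
  by_contra hy'
  exact hy.1 (subset_closure ⟨hy.2, hy'⟩)

theorem isCompact_closure_layer_iff {ξ : Ordinal.{u}} :
    IsCompact (closure (cb W ξ \ kernel W)) ↔ rho W ≤ ξ := by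
  have hset : {ξ | IsCompact (closure (layer W ξ))} =
      {ξ | IsCompact (closure (cb W ξ \ kernel W))} := by
    ext ξ; simp [closure_layer]
  rw [rho, hset]
  refine ⟨fun h => csInf_le' h, fun h => ?_⟩
  have hl := csInf_mem (s := {ξ | IsCompact (closure (cb W ξ \ kernel W))})
    ⟨nu W, by simp [kernel]⟩
  exact hl.of_isClosed_subset isClosed_closure (closure_mono (cb_diff_kernel_antitone h))

theorem rho_le_nu : rho W ≤ nu W :=
  isCompact_closure_layer_iff.1 (by simp [kernel])

/-- By the Lindelöf property, countably many of the complements of W^(ξ), ξ < ω₁, already cover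
their union; the sequence is stable from the supremum of their indices. -/
theorem nu_lt_omega_one [SecondCountableTopology W] : nu W < Ordinal.omega 1 := by
  obtain ⟨T, hT, hTU⟩ := TopologicalSpace.isOpen_iUnion_countable
    (fun ξ : Iio (Ordinal.omega.{u} 1) => (cb W ξ)ᶜ) fun ξ => (isClosed_cb _).isOpen_compl
  have := hT.to_subtype
  have hα : (⨆ t : T, (t : Iio (Ordinal.omega.{u} 1)).1) < Ordinal.omega 1 :=
    Ordinal.iSup_lt_omega_one fun t => t.1.2
  set α := ⨆ t : T, (t : Iio (Ordinal.omega.{u} 1)).1 with hαdef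
  have hα1 : α + 1 < Ordinal.omega 1 :=
    (Cardinal.isSuccLimit_omega 1).succ_lt hα
  refine lt_of_le_of_lt (csInf_le' ?_) hα
  refine Subset.antisymm ?_ (cb_antitone (Order.le_succ α))
  rw [← compl_subset_compl]
  have h1 : (cb W (α + 1))ᶜ ⊆ ⋃ i ∈ T, (cb W i)ᶜ := by
    rw [hTU]
    exact subset_iUnion (fun ξ : Iio (Ordinal.omega.{u} 1) => (cb W ξ)ᶜ) ⟨α + 1, hα1⟩
  refine h1.trans (iUnion₂_subset fun i hi => compl_subset_compl.2 (cb_antitone ?_))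
  exact le_ciSup (f := fun t : T => (t : Iio (Ordinal.omega.{u} 1)).1)
    Ordinal.bddAbove_of_small ⟨i, hi⟩

/-- The bound ξ < ω₁ in the definition of the rank is harmless: ν(W) is countable and D_ν is empty,
so the minimum is attained at or below ν(W). -/
theorem lt_rank_iff [SecondCountableTopology W] {x : kernel W} {ξ : Ordinal.{u}} :
    ξ < rank W x ↔ (x : W) ∈ closure (cb W ξ \ kernel W) := by
  have hν : nu W ∈ {ξ | ξ < Ordinal.omega 1 ∧ (x : W) ∉ closure (cb W ξ \ kernel W)} :=
    ⟨nu_lt_omega_one, by simp [kernel]⟩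
  constructor
  · intro h
    by_contra hx
    have hle : rank W x ≤ nu W := csInf_le' hν
    exact notMem_of_lt_csInf' h ⟨(h.trans_le hle).trans nu_lt_omega_one, hx⟩
  · intro h
    by_contra! hle
    have := csInf_mem (s := {ξ | ξ < Ordinal.omega 1 ∧ (x : W) ∉ closure (cb W ξ \ kernel W)})
      ⟨_, hν⟩
    exact this.2 (closure_mono (cb_diff_kernel_antitone hle) h)

theorem kernelAbove_eq [SecondCountableTopology W] (ξ : Ordinal.{u}) :
    kernelAbove W ξ = kernel W ∩ closure (cb W ξ \ kernel W) := by
  ext x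
  simp only [kernelAbove, mem_ofPred_eq, lt_rank_iff, mem_inter_iff, exists_prop]

theorem isCompact_kernelAbove_iff [SecondCountableTopology W] {ξ : Ordinal.{u}} :
    IsCompact (kernelAbove W ξ) ↔ rhoU W ≤ ξ := by
  refine ⟨fun h => csInf_le' h, fun h => ?_⟩
  have hl : IsCompact (kernelAbove W (rhoU W)) :=
    csInf_mem (s := {ξ | IsCompact (kernelAbove W ξ)})
      ⟨nu W, by simp [kernelAbove_eq, kernel]⟩
  simp only [kernelAbove_eq] at hl ⊢
  exact hl.of_isClosed_subset (isClosed_kernel.inter isClosed_closure)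
    (inter_subset_inter_right _ (closure_mono (cb_diff_kernel_antitone h)))

theorem closure_cb_diff_subset (ξ : Ordinal.{u}) :
    closure (cb W ξ \ kernel W) ⊆ cb W ξ :=
  closure_minimal sdiff_subset (isClosed_cb ξ)

theorem rhoU_le_lam [SecondCountableTopology W] : rhoU W ≤ lam W := by
  refine isCompact_kernelAbove_iff.1 ?_
  rw [kernelAbove_eq, (isClosed_cb_diff_kernel_iff.2 le_rfl).closure_eq,
    inter_sdiff_self]
  exact isCompact_empty

theorem rhoU_le_rho [SecondCountableTopology W] : rhoU W ≤ rho W := by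
  refine isCompact_kernelAbove_iff.1 ?_
  rw [kernelAbove_eq]
  exact (isCompact_closure_layer_iff.2 le_rfl).inter_left isClosed_kernel

end CantorBendixson

/-! ### Clopen separation of closed sets -/

section Separation

variable {W : Type u} [TopologicalSpace W] [OmegaStoneSpace W]

/-- In an `ω`-Stone space, disjoint closed sets are separated by a clopen set. -/
theorem exists_isClopen_separating {F K : Set W} (hF : IsClosed F) (hK : IsClosed K)
    (hFK : Disjoint F K) : ∃ Y, IsClopen Y ∧ F ⊆ Y ∧ Disjoint Y K := by
  classical
  rcases isEmpty_or_nonempty W with hW | hW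
  · exact ⟨∅, isClopen_empty, fun x => (hW.false x).elim, empty_disjoint _⟩
  -- A countable clopen cover whose members each miss `F` or `K` is made disjoint. The pieces coming
  -- from members that meet `F` form `Y`; the other pieces form its complement, so both are open.
  have hloc : ∀ x : W, ∃ U, IsClopen U ∧ x ∈ U ∧ (Disjoint U F ∨ Disjoint U K) := by
    intro x
    have key : ∀ {S : Set W}, IsClosed S → x ∉ S → ∃ U, IsClopen U ∧ x ∈ U ∧ Disjoint U S := by
      intro S hS hx
      obtain ⟨U, hU, hxU, hUS⟩ := loc_compact_Haus_tot_disc_of_zero_dim.exists_subset_of_mem_open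
        (show x ∈ Sᶜ from hx) hS.isOpen_compl
      exact ⟨U, hU, hxU, disjoint_left.2 fun y hy => hUS hy⟩
    by_cases hx : x ∈ F
    · obtain ⟨U, h1, h2, h3⟩ := key hK (disjoint_left.1 hFK hx)
      exact ⟨U, h1, h2, Or.inr h3⟩
    · obtain ⟨U, h1, h2, h3⟩ := key hF hx
      exact ⟨U, h1, h2, Or.inl h3⟩
  choose f hfc hfx hfd using hloc
  obtain ⟨s, hs, hsU⟩ := TopologicalSpace.countable_cover_nhds
    fun x => (hfc x).isOpen.mem_nhds (hfx x)
  have hne : s.Nonempty := by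
    by_contra h
    rw [not_nonempty_iff_eq_empty] at h
    simp [h, eq_comm (a := (∅ : Set W)), univ_eq_empty_iff] at hsU
  obtain ⟨g, rfl⟩ := hs.exists_eq_range hne
  set U : ℕ → Set W := fun n => f (g n) with hU
  have hUcov : ⋃ n, disjointed U n = univ := by
    rw [iUnion_disjointed, ← hsU, biUnion_range]
  have hVo : ∀ n, IsOpen (disjointed U n) := fun n =>
    (disjointedRec (p := IsClopen) (fun _ _ h => h.diff (hfc _)) (hfc (g n))).isOpen
  have hcompl : (⋃ n ∈ {n | ¬ Disjoint (U n) F}, disjointed U n)ᶜ =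
      ⋃ n ∈ {n | Disjoint (U n) F}, disjointed U n := by
    ext x
    obtain ⟨n, hn⟩ := mem_iUnion.1 (hUcov.symm ▸ mem_univ x)
    have huniq : ∀ m, x ∈ disjointed U m → m = n := fun m hm => by
      by_contra hne
      exact disjoint_left.1 (disjoint_disjointed U hne) hm hn
    simp only [mem_compl_iff, mem_iUnion, mem_ofPred_eq, exists_prop, not_exists, not_and]
    constructor
    · intro h
      by_cases hd : Disjoint (U n) F
      · exact ⟨n, hd, hn⟩
      · exact (h n hd hn).elim
    · rintro ⟨m, hm, hxm⟩ k hk hxk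
      rw [huniq k hxk, ← huniq m hxm] at hk
      exact hk hm
  refine ⟨⋃ n ∈ {n | ¬ Disjoint (U n) F}, disjointed U n, ⟨⟨?_⟩, ?_⟩, ?_, ?_⟩
  · rw [hcompl]
    exact isOpen_biUnion fun n _ => hVo n
  · exact isOpen_biUnion fun n _ => hVo n
  · intro x hx
    obtain ⟨n, hn⟩ := mem_iUnion.1 (hUcov.symm ▸ mem_univ x)
    exact mem_biUnion (fun hd : Disjoint (U n) F =>
      disjoint_left.1 hd (disjointed_subset U n hn) hx) hn
  · simp only [disjoint_iUnion_left]
    intro n hn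
    exact ((hfd (g n)).resolve_left hn).mono_left (disjointed_subset U n)

theorem exists_isClopen_isCompact_between {C K : Set W} (hC : IsCompact C) (hK : IsClosed K)
    (hCK : Disjoint C K) : ∃ Y, IsClopen Y ∧ IsCompact Y ∧ C ⊆ Y ∧ Disjoint Y K := by
  obtain ⟨L, hL, hCL, hLK⟩ := exists_compact_between hC hK.isOpen_compl
    (subset_compl_iff_disjoint_right.2 hCK)
  obtain ⟨Y, hY, hCY, hYL⟩ := exists_isClopen_separating hC.isClosed
    (isOpen_interior (s := L)).isClosed_compl (disjoint_compl_right_iff_subset.2 hCL)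
  have hYL' : Y ⊆ L := (disjoint_compl_right_iff_subset.1 hYL).trans interior_subset
  exact ⟨Y, hY, hL.of_isClosed_subset hY.isClosed hYL', hCY,
    subset_compl_iff_disjoint_right.1 (hYL'.trans hLK)⟩

end Separation

/-! ### Invariants of open and clopen subspaces -/

section OpenSubspace

variable {W : Type u} [TopologicalSpace W] {X : Set W}

theorem mem_derivedSet_preimage_val (hX : IsOpen X) {A : Set W} {x : X} :
    x ∈ derivedSet (Subtype.val ⁻¹' A : Set X) ↔ (x : W) ∈ derivedSet A := by
  rw [mem_derivedSet, mem_derivedSet, accPt_iff_frequently, accPt_iff_frequently,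
    ← hX.isOpenEmbedding_subtypeVal.map_nhds_eq, Filter.frequently_map]
  simp [Subtype.ext_iff]

theorem cb_eq_preimage (hX : IsOpen X) (ξ : Ordinal.{u}) :
    cb X ξ = Subtype.val ⁻¹' cb W ξ := by
  induction ξ using Ordinal.limitRecOn with
  | zero => simp [cb_zero]
  | add_one a ha =>
    ext x
    rw [cb_add_one, cb_add_one, ha]
    exact mem_derivedSet_preimage_val hX
  | limit a ha ih =>
    rw [cb_limit X ha, cb_limit W ha, preimage_iInter]
    exact iInter_congr fun i => ih i i.2

theorem kernel_eq_preimage (hX : IsOpen X) : kernel X = Subtype.val ⁻¹' kernel W := by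
  -- The two sequences may stabilize at different stages; the kernels are compared at a common later
  -- one.
  rw [kernel_eq_cb (le_max_left (nu X) (nu W)), kernel_eq_cb (le_max_right (nu X) (nu W)),
    cb_eq_preimage hX]

theorem cb_diff_kernel_eq_preimage (hX : IsOpen X) (ξ : Ordinal.{u}) :
    cb X ξ \ kernel X = Subtype.val ⁻¹' (cb W ξ \ kernel W) := by
  rw [cb_eq_preimage hX, kernel_eq_preimage hX, preimage_sdiff]

theorem closure_preimage_val (hX : IsOpen X) (A : Set W) :
    closure (Subtype.val ⁻¹' A : Set X) = Subtype.val ⁻¹' closure A :=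
  (hX.isOpenMap_subtype_val.preimage_closure_eq_closure_preimage continuous_subtype_val A).symm

theorem rank_eq_of_isOpen (hX : IsOpen X) (x : X) (h : x ∈ kernel X)
    (h' : (x : W) ∈ kernel W) : rank X ⟨x, h⟩ = rank W ⟨x, h'⟩ := by
  simp only [rank, cb_diff_kernel_eq_preimage hX, closure_preimage_val hX, mem_preimage]

theorem isCompact_preimage_val_iff {A : Set W} (hA : A ⊆ X) :
    IsCompact (Subtype.val ⁻¹' A : Set X) ↔ IsCompact A := by
  rw [Subtype.isCompact_iff, Subtype.image_preimage_coe, inter_eq_right.2 hA]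

theorem kernelAbove_eq_preimage (hX : IsOpen X) (ξ : Ordinal.{u}) :
    kernelAbove X ξ = Subtype.val ⁻¹' kernelAbove W ξ := by
  ext x
  simp only [kernelAbove, mem_ofPred_eq, mem_preimage]
  constructor
  · rintro ⟨h, hlt⟩
    have h' : (x : W) ∈ kernel W := by rwa [kernel_eq_preimage hX] at h
    exact ⟨h', by rwa [← rank_eq_of_isOpen hX x h h']⟩
  · rintro ⟨h', hlt⟩
    have h : x ∈ kernel X := by rwa [kernel_eq_preimage hX]
    exact ⟨h, by rwa [rank_eq_of_isOpen hX x h h']⟩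

theorem rhoU_eq_of_kernel_subset (hX : IsOpen X) (hK : kernel W ⊆ X) : rhoU X = rhoU W := by
  have h : ∀ ξ, kernelAbove W ξ ⊆ X := fun ξ x hx => hK hx.1
  simp only [rhoU, kernelAbove_eq_preimage hX, isCompact_preimage_val_iff (h _)]

theorem lam_eq_of_kernel_subset (hX : IsClopen X) (hK : kernel W ⊆ X) : lam X = lam W := by
  have h : ∀ ξ, IsClosed (Subtype.val ⁻¹' (cb W ξ \ kernel W) : Set X) ↔
      IsClosed (cb W ξ \ kernel W) := by
    intro ξ
    refine ⟨fun hc => ?_, fun hc => hc.preimage continuous_subtype_val⟩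
    have h1 := hX.isClosed.isClosedEmbedding_subtypeVal.isClosedMap _ hc
    rw [Subtype.image_preimage_coe] at h1
    -- Outside `X` there are no kernel points, so that part is automatically closed.
    have h2 : cb W ξ \ kernel W = X ∩ (cb W ξ \ kernel W) ∪ (Xᶜ ∩ cb W ξ) := by
      ext x
      have := @hK x
      simp only [mem_sdiff, mem_union, mem_inter_iff, mem_compl_iff]
      tauto
    rw [h2]
    exact h1.union (hX.compl.isClosed.inter (isClosed_cb ξ))
  simp only [lam, cb_diff_kernel_eq_preimage hX.isOpen, h]

theorem isCompact_closure_preimage_iff (hX : IsClopen X) {A : Set W} :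
    IsCompact (closure (Subtype.val ⁻¹' A : Set X)) ↔ IsCompact (closure (X ∩ A)) := by
  have : closure (X ∩ A) = X ∩ closure A :=
    ((closure_inter_subset_inter_closure _ _).trans_eq (by rw [hX.isClosed.closure_eq])).antisymm
      hX.isOpen.inter_closure
  rw [closure_preimage_val hX.isOpen, this, Subtype.isCompact_iff, Subtype.image_preimage_coe]

theorem rho_le_iff_of_isClopen (hX : IsClopen X) {ξ : Ordinal.{u}} :
    rho X ≤ ξ ↔ IsCompact (closure (X ∩ (cb W ξ \ kernel W))) := by
  rw [← isCompact_closure_layer_iff, cb_diff_kernel_eq_preimage hX.isOpen,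
    isCompact_closure_preimage_iff hX]

theorem nu_le_iff_of_isOpen (hX : IsOpen X) {ξ : Ordinal.{u}} :
    nu X ≤ ξ ↔ Disjoint X (cb W ξ \ kernel W) := by
  rw [nu_le_iff, cb_diff_kernel_eq_preimage hX, Subtype.preimage_coe_eq_empty,
    disjoint_iff_inter_eq_empty]

end OpenSubspace

end OmegaStone

namespace OmegaStone

/-! ### The invariant n -/

section Num

variable {W : Type u} [TopologicalSpace W]

theorem num_eq_bot (h : ∀ μ, nu W = μ + 1 → (cb W μ \ kernel W).Infinite) : num W = ⊥ :=
  dif_neg fun ⟨μ, hμ, hf⟩ => h μ hμ hf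

/-- A finite D_μ with ν = μ + 1 would be closed, giving λ ≤ μ < ν. -/
theorem num_eq_bot_of_lam_eq_nu [T1Space W] (h : lam W = nu W) : num W = ⊥ := by
  refine num_eq_bot fun μ hμ hf => ?_
  have := isClosed_cb_diff_kernel_iff.1 hf.isClosed
  rw [h, hμ] at this
  exact (Order.lt_succ μ).not_ge this

theorem num_eq_bot_of_rho_eq_nu [T2Space W] (h : rho W = nu W) : num W = ⊥ := by
  refine num_eq_bot fun μ hμ hf => ?_
  have := isCompact_closure_layer_iff.1 hf.isCompact.closure
  rw [h, hμ] at this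
  exact (Order.lt_succ μ).not_ge this

theorem num_eq_of_isOpen {Y : Set W} (hY : IsOpen Y) (hν : nu Y = nu W)
    (h : ∀ μ, nu W = μ + 1 → cb W μ \ kernel W ⊆ Y) : num Y = num W := by
  have himg : ∀ μ, nu W = μ + 1 →
      Subtype.val '' (cb Y μ \ kernel Y) = cb W μ \ kernel W := fun μ hμ => by
    rw [cb_diff_kernel_eq_preimage hY, Subtype.image_preimage_coe, inter_eq_right.2 (h μ hμ)]
  by_cases hex : ∃ μ, nu W = μ + 1 ∧ (cb W μ \ kernel W).Finite
  · obtain ⟨μ, hμ, hf⟩ := hex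
    have hfY : (cb Y μ \ kernel Y).Finite :=
      Finite.of_finite_image ((himg μ hμ).symm ▸ hf) Subtype.val_injective.injOn
    rw [num_eq W hμ hf, num_eq Y (hν.trans hμ) hfY, ← himg μ hμ,
      ncard_image_of_injective _ Subtype.val_injective]
  · rw [num_eq_bot fun μ hμ hf => hex ⟨μ, hμ, hf⟩, num_eq_bot fun μ hμ hf => hex ⟨μ, ?_, ?_⟩]
    · exact hν ▸ hμ
    · rw [← himg μ (hν ▸ hμ)]
      exact hf.image _

end Num

/-! ### Properties of the two pieces -/

section Decomposition

variable {W : Type u} [TopologicalSpace W] {Y : Set W}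

theorem stronglyUniform_compl [OmegaStoneSpace W] (hY : IsClopen Y)
    (hYK : Disjoint Y (kernel W)) (hlam : cb W (lam W) \ kernel W ⊆ Y)
    (hrho : IsCompact (closure (Yᶜ ∩ (cb W (rhoU W) \ kernel W)))) :
    StronglyUniform (Yᶜ : Set W) ∧ lam (Yᶜ : Set W) = lam W ∧
      Subtype.val '' kernel (Yᶜ : Set W) = kernel W ∧
      ∀ (x : (Yᶜ : Set W)) (hX : x ∈ kernel (Yᶜ : Set W)) (hW : (x : W) ∈ kernel W),
        rank (Yᶜ : Set W) ⟨x, hX⟩ = rank W ⟨(x : W), hW⟩ := by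
  have hX := hY.compl
  have hK : kernel W ⊆ Yᶜ := subset_compl_iff_disjoint_left.2 hYK
  have hl := lam_eq_of_kernel_subset hX hK
  have hU := rhoU_eq_of_kernel_subset hX.isOpen hK
  refine ⟨⟨?_, ?_⟩, hl, ?_, rank_eq_of_isOpen hX.isOpen⟩
  · refine le_antisymm ?_ lam_le_nu
    rw [hl, nu_le_iff_of_isOpen hX.isOpen]
    exact disjoint_compl_left_iff_subset.2 hlam
  · refine rhoU_le_rho.antisymm ?_
    rw [hU]
    exact (rho_le_iff_of_isClopen hX).2 hrho
  · rw [kernel_eq_preimage hX.isOpen, Subtype.image_preimage_coe, inter_eq_right.2 hK]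

theorem scattered_of_disjoint_kernel (hY : IsOpen Y) (hYK : Disjoint Y (kernel W)) :
    Scattered Y := by
  rw [Scattered, kernel_eq_preimage hY, Subtype.preimage_coe_eq_empty]
  exact hYK.inter_eq

theorem nu_eq_of_lam_lt_nu (hY : IsOpen Y) (hlam : cb W (lam W) \ kernel W ⊆ Y)
    (h : lam W < nu W) : nu Y = nu W := by
  refine le_antisymm ((nu_le_iff_of_isOpen hY).2 (by simp [kernel])) ?_
  -- If ν(Y) < ν(W), then at stage max(ν(Y), λ(W)) < ν(W) the set D lies in `Y` and also misses it,
  -- hence is empty.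
  by_contra! hlt
  have hd := (nu_le_iff_of_isOpen hY).1 (le_max_left (nu Y) (lam W))
  have hsub := (cb_diff_kernel_antitone (le_max_right (nu Y) (lam W))).trans hlam
  exact (max_lt hlt h).not_ge (nu_le_iff.2 (hd.eq_bot_of_ge hsub))

theorem num_eq_of_lam_lt_nu (hY : IsOpen Y) (hlam : cb W (lam W) \ kernel W ⊆ Y)
    (h : lam W < nu W) : num Y = num W := by
  refine num_eq_of_isOpen hY (nu_eq_of_lam_lt_nu hY hlam h) fun μ hμ => ?_
  refine (cb_diff_kernel_antitone ?_).trans hlam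
  rw [hμ] at h
  exact Order.lt_succ_iff.1 h

theorem rho_eq_of_isCompact [T2Space W] (hY : IsClopen Y) {C : Set W} (hC : IsCompact C)
    (hCY : (cb W (rhoU W) \ kernel W) \ C ⊆ Y) (h : rhoU W < rho W) : rho Y = rho W := by
  refine le_antisymm ?_ ?_
  · rw [rho_le_iff_of_isClopen hY]
    exact (isCompact_closure_layer_iff.2 le_rfl).of_isClosed_subset isClosed_closure
      (closure_mono inter_subset_right)
  · by_contra! hlt
    -- At stage max(ρ(Y), ρ_U(W)), D is covered by `C` and a part of `Y` with compact closure.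
    refine (max_lt hlt h).not_ge (isCompact_closure_layer_iff.1 ?_)
    refine (hC.union ((rho_le_iff_of_isClopen hY).1 le_rfl)).closure_of_subset fun x hx => ?_
    by_cases hxC : x ∈ C
    · exact Or.inl hxC
    · exact Or.inr <| subset_closure
        ⟨hCY ⟨cb_diff_kernel_antitone (le_max_right _ _) hx, hxC⟩,
          cb_diff_kernel_antitone (le_max_left _ _) hx⟩

/-- The only limits that D_ξ can lack are kernel points; these form K_ξ and are removed along with
`C`. -/
theorem isClosed_cb_diff_kernel_diff [SecondCountableTopology W] {C : Set W} (hC : IsOpen C)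
    {ξ : Ordinal.{u}} (h : kernelAbove W ξ ⊆ C) : IsClosed ((cb W ξ \ kernel W) \ C) := by
  have : (cb W ξ \ kernel W) \ C = closure (cb W ξ \ kernel W) ∩ Cᶜ := by
    ext x
    refine ⟨fun hx => ⟨subset_closure hx.1, hx.2⟩, fun hx => ⟨⟨closure_cb_diff_subset ξ hx.1,
      fun hK => hx.2 (h ?_)⟩, hx.2⟩⟩
    rw [kernelAbove_eq]
    exact ⟨hK, hx.1⟩
  rw [this]
  exact isClosed_closure.inter hC.isClosed_compl

end Decomposition

end OmegaStone

/-! ### Choice of the clopen set in the four cases -/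

theorem mainTheorem4 (W : Type u) [TopologicalSpace W] [OmegaStone.OmegaStoneSpace W] :
    ∃ X Y : Set W, IsClopen X ∧ IsClopen Y ∧ X ∪ Y = univ ∧ Disjoint X Y ∧
      (X = ∅ ∨
        (OmegaStone.StronglyUniform X ∧
          OmegaStone.lam X = OmegaStone.lam W ∧
          Subtype.val '' OmegaStone.kernel X = OmegaStone.kernel W ∧
          ∀ (x : X) (hX : x ∈ OmegaStone.kernel X)
            (hW : (x : W) ∈ OmegaStone.kernel W),
            OmegaStone.rank X ⟨x, hX⟩ = OmegaStone.rank W ⟨(x : W), hW⟩)) ∧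
      ((OmegaStone.rho W = OmegaStone.rhoU W ∧
          OmegaStone.nu W = OmegaStone.lam W) → Y = ∅) ∧
      (¬ (OmegaStone.rho W = OmegaStone.rhoU W ∧
          OmegaStone.nu W = OmegaStone.lam W) →
        OmegaStone.Scattered Y ∧
        OmegaStone.num Y = OmegaStone.num W ∧
        (OmegaStone.rhoU W ≠ OmegaStone.rho W →
          OmegaStone.rho Y = OmegaStone.rho W) ∧
        (OmegaStone.rhoU W = OmegaStone.rho W → OmegaStone.rho Y = 0) ∧
        (OmegaStone.lam W ≠ OmegaStone.nu W →
          OmegaStone.nu Y = OmegaStone.nu W) ∧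
        (OmegaStone.lam W = OmegaStone.nu W →
          OmegaStone.nu Y = OmegaStone.rho W)) := by
  open OmegaStone in
    suffices h : ∃ Y : Set W, IsClopen Y ∧ Disjoint Y (kernel W) ∧
        cb W (lam W) \ kernel W ⊆ Y ∧
        IsCompact (closure (Yᶜ ∩ (cb W (rhoU W) \ kernel W))) ∧
        ((rho W = rhoU W ∧ nu W = lam W) → Y = ∅) ∧
        (¬ (rho W = rhoU W ∧ nu W = lam W) →
          num Y = num W ∧ (rhoU W ≠ rho W → rho Y = rho W) ∧ (rhoU W = rho W → rho Y = 0) ∧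
          (lam W ≠ nu W → nu Y = nu W) ∧ (lam W = nu W → nu Y = rho W)) by
      obtain ⟨Y, hY, hYK, hlam, hrho, hA, hB⟩ := h
      exact ⟨Yᶜ, Y, hY.compl, hY, compl_union_self Y, disjoint_compl_left,
        -- The second alternative holds even when the complement of `Y` is empty.
        Or.inr (stronglyUniform_compl hY hYK hlam hrho), hA,
        fun hn => ⟨scattered_of_disjoint_kernel hY.isOpen hYK, hB hn⟩⟩
    have hrle : rhoU W ≤ rho W := rhoU_le_rho
    have hlle : lam W ≤ nu W := lam_le_nu
    have hlamK : Disjoint (cb W (lam W) \ kernel W) (kernel W) := disjoint_sdiff_left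
    have hlamc : IsClosed (cb W (lam W) \ kernel W) := isClosed_cb_diff_kernel_iff.2 le_rfl
    rcases hrle.eq_or_lt with hr | hr
    · have hX : ∀ Y : Set W, IsCompact (closure (Yᶜ ∩ (cb W (rhoU W) \ kernel W))) := fun Y =>
        (isCompact_closure_layer_iff.2 hr.ge).of_isClosed_subset isClosed_closure
          (closure_mono inter_subset_right)
      rcases hlle.eq_or_lt with hl | hl
      · refine ⟨∅, isClopen_empty, empty_disjoint _, ?_, hX _, fun _ => rfl,
          fun hn => (hn ⟨hr.symm, hl.symm⟩).elim⟩
        exact (nu_le_iff.1 hl.ge).subset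
      · have hc : IsCompact (cb W (lam W) \ kernel W) := by
          rw [← hlamc.closure_eq]
          -- Here ρ = ρ_U ≤ λ, so D_λ is compact as well as closed.
          exact isCompact_closure_layer_iff.2 (hr.symm.trans_le rhoU_le_lam)
        obtain ⟨Y, hY, hYc, hFY, hYK⟩ := exists_isClopen_isCompact_between hc isClosed_kernel hlamK
        refine ⟨Y, hY, hYK, hFY, hX _, fun h => (hl.ne h.2.symm).elim, fun _ =>
          ⟨num_eq_of_lam_lt_nu hY.isOpen hFY hl, fun h => (h hr).elim, fun _ => ?_,
            fun _ => nu_eq_of_lam_lt_nu hY.isOpen hFY hl, fun h => (hl.ne h).elim⟩⟩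
        refine nonpos_iff_eq_zero.1 ((rho_le_iff_of_isClopen hY).2 ?_)
        exact hYc.closure_of_subset inter_subset_left
    · have hXc : ∀ {Y C : Set W}, IsCompact C → (cb W (rhoU W) \ kernel W) \ C ⊆ Y →
          IsCompact (closure (Yᶜ ∩ (cb W (rhoU W) \ kernel W))) := fun hC hCY =>
        hC.closure_of_subset fun x hx => by_contra fun hxC => hx.1 (hCY ⟨hx.2, hxC⟩)
      have hKU : IsCompact (kernelAbove W (rhoU W)) := isCompact_kernelAbove_iff.2 le_rfl
      rcases hlle.eq_or_lt with hl | hl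
      -- Including closure D_ρ in `C` and keeping `Y` off `C` gives ν(Y) ≤ ρ(W); the reverse comes
      -- from ρ(W) = ρ(Y) ≤ ν(Y).
      · obtain ⟨C, hC, hCc, hCsub, -⟩ := exists_isClopen_isCompact_between
          (hKU.union (isCompact_closure_layer_iff.2 (le_refl (rho W)))) isClosed_empty
          (disjoint_empty _)
        have hF := isClosed_cb_diff_kernel_diff hC.isOpen (subset_union_left.trans hCsub)
        obtain ⟨Y, hY, hFY, hYK⟩ := exists_isClopen_separating hF
          (isClosed_kernel.union hC.isClosed)
          (disjoint_union_right.2 ⟨disjoint_sdiff_left.mono_left sdiff_subset, disjoint_sdiff_left⟩)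
        rw [disjoint_union_right] at hYK
        have hρ : rho Y = rho W := rho_eq_of_isCompact hY hCc hFY hr
        have hν : nu Y = rho W := by
          refine le_antisymm ((nu_le_iff_of_isOpen hY.isOpen).2 (hYK.2.mono_right ?_))
            (hρ.symm.trans_le rho_le_nu)
          exact subset_closure.trans (subset_union_right.trans hCsub)
        refine ⟨Y, hY, hYK.1, ?_, hXc hCc hFY, fun h => (hr.ne h.1.symm).elim, fun _ => ⟨?_,
          fun _ => hρ, fun h => (hr.ne h).elim, fun h => (h hl).elim, fun _ => hν⟩⟩
        · exact (nu_le_iff.1 hl.ge).trans_subset (empty_subset _)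
        -- Both sides are -∞: for `W` because λ = ν, for `Y` because ρ(Y) = ν(Y).
        · rw [num_eq_bot_of_lam_eq_nu hl, num_eq_bot_of_rho_eq_nu (hρ.trans hν.symm)]
      · obtain ⟨C, hC, hCc, hCsub, -⟩ := exists_isClopen_isCompact_between hKU isClosed_empty
          (disjoint_empty _)
        have hF := isClosed_cb_diff_kernel_diff hC.isOpen hCsub
        obtain ⟨Y, hY, hFY, hYK⟩ := exists_isClopen_separating (hlamc.union hF) isClosed_kernel
          (disjoint_union_left.2 ⟨hlamK, disjoint_sdiff_left.mono_left sdiff_subset⟩)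
        rw [union_subset_iff] at hFY
        exact ⟨Y, hY, hYK, hFY.1, hXc hCc hFY.2, fun h => (hr.ne h.1.symm).elim, fun _ =>
          ⟨num_eq_of_lam_lt_nu hY.isOpen hFY.1 hl, fun _ => rho_eq_of_isCompact hY hCc hFY.2 hr,
            fun h => (hr.ne h).elim, fun _ => nu_eq_of_lam_lt_nu hY.isOpen hFY.1 hl,
            fun h => (hl.ne h).elim⟩⟩
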